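/- Fix parameters: an integer $M\ge 1$, an arrival probability $p\in(0,1]$, a jamming probability $q\in(0,1)$, departure probabilities $0\le r<r'\le 1$, a holding cost $C>0$, and an arbitrary real tax $\lambda$. Put $$\bar P_d=\binom{M}{d}\left[q\,r^d(1-r)^{M-d}+(1-q)\,r'^d(1-r')^{M-d}\right],\qquad 0\le d\le M.$$ Consider the Markov decision process of one base station: the state $X_n\in\{0,1,2,\dots\}$ is the number of associated users, and in each slot $n$ a control $u_n\in\{0,1\}$ (reject/accept) is chosen, possibly at random, on the basis of the current state $X_n$ and of the states, controls, arrivals and departures of the past slots. Then $X_{n+1}=X_n-D_n+\varsigma_{n+1}u_n$, where $\varsigma_{n+1}$ and $D_n$ are drawn independently of each other and, given $X_n$, of the past and of $u_n$; $\varsigma_{n+1}$ is Bernoulli($p$), and, given $X_n=x$, $D_n=d$ has probability $P_d(x)=\bar P_d$ for $0\le d<\min(x,M)$ and $P_d(x)=\sum_{k=\min(x,M)}^{M}\bar P_k$ for $d=\min(x,M)$. The cost of a policy $\pi$ from the initial state $x$ is $$J(\pi,x)=\limsup_{T\to\infty}\frac1T\sum_{n=0}^{T-1}\mathbb E\left[CX_n+\lambda(1-u_n)\,\middle|\,X_0=x\right].$$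 For $\alpha\in(0,1)$ let $V^\alpha(x)$ be the infimum over stationary policies of $\sum_{n\ge0}\alpha^n\,\mathbb E[CX_n+\lambda(1-u_n)\mid X_0=x]$. Call $V$ a value function if it is the pointwise limit of $V^{\alpha_k}(\cdot)-V^{\alpha_k}(0)$ for some sequence $\alpha_k\in(0,1)$ with $\alpha_k\to1$. Write $$A_V(x)=\sum_{d=0}^{\min(x,M)}P_d(x)\left[pV(x-d+1)+(1-p)V(x-d)\right],\qquad R_V(x)=\lambda+\sum_{d=0}^{\min(x,M)}P_d(x)V(x-d).$$ Then a value function exists, and for every value function $V$ there are a real number $\eta$ and integers $-1\le s\le t$ such that: 1. $V(x)=Cx-\eta+\min\{A_V(x),R_V(x)\}$ for all states $x$; 2. accepting is optimal in state $x$, i.e. $A_V(x)\le R_V(x)$, if and only if $x\le t$; rejecting is optimal in state $x$, i.e. $R_V(x)\le A_V(x)$, if and only if $x>s$; 3. for every integer $k\in[s,t]$, the threshold policy that accepts in the states $x\le k$ and rejects in the states $x>k$ is optimal from every initial state: its cost is $\eta$ from every initial state $x$, and $J(\pi,x)\ge\eta$ for every policy $\pi$ and every $x$. -/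

import Mathlib

open Filter Topology

/-- The parameters of one base station. Each slot has `M ≥ 1` mini-slots; a user arrives in a slot
with probability `p`; the channel is jammed in a slot with probability `q`; in each mini-slot a user
departs (if one is present) with probability `r` if the slot is jammed and `r'` if it is not;
`C` is the holding cost per user and slot. -/
structure BaseStation where
  M : ℕ
  p : ℝ
  q : ℝ
  r : ℝ
  r' : ℝ
  C : ℝ
  one_le_M : 1 ≤ M
  p_pos : 0 < p
  p_le_one : p ≤ 1
  q_pos : 0 < q
  q_lt_one : q < 1
  r_nonneg : 0 ≤ r
  r_lt_r' : r < r'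
  r'_le_one : r' ≤ 1
  C_pos : 0 < C

noncomputable section

namespace BaseStation

variable (B : BaseStation)

/-- Probability that exactly `d` of the `M` mini-slots of a slot carry a departure opportunity. -/
def serviceProb (d : ℕ) : ℝ :=
  (B.M.choose d : ℝ) *
    (B.r ^ d * (1 - B.r) ^ (B.M - d) * B.q + B.r' ^ d * (1 - B.r') ^ (B.M - d) * (1 - B.q))

/-- Probability of `d` departures in a slot that starts with `x` users. -/
def depProb (x d : ℕ) : ℝ :=
  if d < min x B.M then B.serviceProb d
  else if d = min x B.M then ∑ k ∈ Finset.Icc (min x B.M) B.M, B.serviceProb k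
  else 0

theorem serviceProb_nonneg (d : ℕ) : 0 ≤ B.serviceProb d := by
  have h1 := B.r_nonneg
  have h2 := B.r_lt_r'
  have h3 := B.r'_le_one
  have h4 : 0 ≤ 1 - B.r := by linarith
  have h5 : 0 ≤ 1 - B.r' := by linarith
  have h6 : 0 ≤ B.r' := by linarith
  have h7 := B.q_pos.le
  have h8 : 0 ≤ 1 - B.q := by linarith [B.q_lt_one]
  unfold serviceProb
  positivity

theorem sum_serviceProb : ∑ d ∈ Finset.range (B.M + 1), B.serviceProb d = 1 := by
  have key : ∀ a : ℝ, ∑ d ∈ Finset.range (B.M + 1),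
      (B.M.choose d : ℝ) * (a ^ d * (1 - a) ^ (B.M - d)) = 1 := by
    intro a
    have h := add_pow a (1 - a) B.M
    rw [add_sub_cancel, one_pow] at h
    exact (Finset.sum_congr rfl fun d _ => by ring).trans h.symm
  have e : ∀ d, B.serviceProb d =
      (B.M.choose d : ℝ) * (B.r ^ d * (1 - B.r) ^ (B.M - d)) * B.q +
      (B.M.choose d : ℝ) * (B.r' ^ d * (1 - B.r') ^ (B.M - d)) * (1 - B.q) := by
    intro d
    unfold serviceProb
    ring
  simp only [e]
  rw [Finset.sum_add_distrib, ← Finset.sum_mul, ← Finset.sum_mul, key, key]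
  ring

theorem depProb_nonneg (x d : ℕ) : 0 ≤ B.depProb x d := by
  unfold depProb
  split_ifs
  · exact B.serviceProb_nonneg d
  · exact Finset.sum_nonneg fun k _ => B.serviceProb_nonneg k
  · exact le_rfl

theorem sum_depProb (x : ℕ) : ∑ d ∈ Finset.range (min x B.M + 1), B.depProb x d = 1 := by
  rw [Finset.sum_range_succ]
  have h1 : ∑ d ∈ Finset.range (min x B.M), B.depProb x d =
      ∑ d ∈ Finset.range (min x B.M), B.serviceProb d :=
    Finset.sum_congr rfl fun d hd => by simp only [depProb, if_pos (Finset.mem_range.1 hd)]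
  have h2 : B.depProb x (min x B.M) = ∑ k ∈ Finset.Icc (min x B.M) B.M, B.serviceProb k := by
    simp [depProb]
  rw [h1, h2, ← B.sum_serviceProb, ← Finset.Ico_add_one_right_eq_Icc]
  exact Finset.sum_range_add_sum_Ico _ (by omega)

/-- Law of the number of departures in a slot that starts with `x` users. -/
def depLaw (x : ℕ) : PMF ℕ :=
  PMF.ofFinset (fun d => ENNReal.ofReal (B.depProb x d)) (Finset.range (min x B.M + 1))
    (by
      rw [← ENNReal.ofReal_sum_of_nonneg fun d _ => B.depProb_nonneg x d, B.sum_depProb,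
        ENNReal.ofReal_one])
    (by
      intro d hd
      have h : min x B.M < d := by
        rw [Finset.mem_range] at hd
        omega
      simp [depProb, h.not_gt, h.ne'])

/-- Law of the arrival in a slot: `true` (a user arrives) with probability `p`. -/
def arrLaw : PMF Bool :=
  PMF.ofFintype (fun a => ENNReal.ofReal (if a then B.p else 1 - B.p))
    (by
      have h : 0 ≤ 1 - B.p := by linarith [B.p_le_one]
      rw [Fintype.sum_bool]
      simp only [if_true, Bool.false_eq_true, if_false]
      rw [← ENNReal.ofReal_add B.p_pos.le h, add_sub_cancel, ENNReal.ofReal_one])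

/-- What happened in a past slot: the number of users at its start, the control (`true` = accept),
whether a user arrived, and the number of departures. -/
abbrev SlotRecord : Type := ℕ × Bool × Bool × ℕ

/-- A non-anticipating policy, possibly history dependent and randomized: given the records of all
past slots (most recent first) and the current state, the law of the current control. -/
abbrev Policy : Type := List SlotRecord → ℕ → PMF Bool

/-- The stationary policy whose control has law `f x` in state `x`. -/
def stationary (f : ℕ → PMF Bool) : Policy := fun _ x => f x

/-- The threshold policy: accept in the states `x ≤ k`, reject in the states `x > k`
(`k = -1`: always reject). -/
def thresholdPolicy (k : ℤ) : Policy := stationary fun x => PMF.pure (decide ((x : ℤ) ≤ k))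

/-- Joint law of the records of the slots before slot `n` and of the state `X n`, under the policy
`π` and with `X 0 = x₀`. The control, the arrival and the departures of a slot are drawn given the
past, and the state changes by `X (n+1) = X n - D n + ς (n+1) * u n`. -/
def law (π : Policy) (x₀ : ℕ) : ℕ → PMF (List SlotRecord × ℕ)
  | 0 => PMF.pure ([], x₀)
  | n + 1 => (law π x₀ n).bind fun s =>
      (π s.1 s.2).bind fun u =>
        B.arrLaw.bind fun a =>
          (B.depLaw s.2).bind fun d =>
            PMF.pure ((s.2, u, a, d) :: s.1, s.2 - d + (if a && u then 1 else 0))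

/-- Joint law of the state `X n` and the control `u n`. -/
def stateControlLaw (π : Policy) (x₀ n : ℕ) : PMF (ℕ × Bool) :=
  (B.law π x₀ n).bind fun s => (π s.1 s.2).map fun u => (s.2, u)

/-- The expected cost `E [C * X n + lam * (1 - u n)]` of slot `n` (the law has finite support). -/
def stageCost (lam : ℝ) (π : Policy) (x₀ n : ℕ) : ℝ :=
  ∑' z : ℕ × Bool,
    (B.stateControlLaw π x₀ n z).toReal * (B.C * z.1 + lam * (1 - if z.2 then 1 else 0))

/-- The long-run expected average cost, as an extended real: it is `⊤` for some policies. -/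
def avgCost (lam : ℝ) (π : Policy) (x₀ : ℕ) : EReal :=
  limsup (fun T : ℕ => (((1 / (T : ℝ)) * ∑ n ∈ Finset.range T, B.stageCost lam π x₀ n : ℝ) : EReal))
    atTop

/-- The expected total discounted cost. -/
def discCost (lam α : ℝ) (π : Policy) (x₀ : ℕ) : ℝ :=
  ∑' n : ℕ, α ^ n * B.stageCost lam π x₀ n

/-- The value function of the discounted problem: the least discounted cost over all stationary
policies. -/
def discValue (lam α : ℝ) (x : ℕ) : ℝ :=
  ⨅ f : ℕ → PMF Bool, B.discCost lam α (stationary f) x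

/-- `V` is a value function of the average-cost problem, by the vanishing-discount limit: it is the
limit of the functions `x ↦ V^α x - V^α 0` as `α ↑ 1`, at least along some sequence. -/
def IsValueFunction (lam : ℝ) (V : ℕ → ℝ) : Prop :=
  ∃ α : ℕ → ℝ, (∀ k, 0 < α k ∧ α k < 1) ∧ Tendsto α atTop (𝓝 1) ∧
    ∀ x, Tendsto (fun k => B.discValue lam (α k) x - B.discValue lam (α k) 0) atTop (𝓝 (V x))

/-- The term of the dynamic programming equation for accepting in state `x`. -/
def acceptTerm (V : ℕ → ℝ) (x : ℕ) : ℝ :=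
  ∑ d ∈ Finset.range (min x B.M + 1),
    B.depProb x d * (B.p * V (x - d + 1) + (1 - B.p) * V (x - d))

/-- The term of the dynamic programming equation for rejecting in state `x`. -/
def rejectTerm (lam : ℝ) (V : ℕ → ℝ) (x : ℕ) : ℝ :=
  lam + ∑ d ∈ Finset.range (min x B.M + 1), B.depProb x d * V (x - d)

/-- The average-cost dynamic programming equation. -/
def SolvesDPE (lam : ℝ) (V : ℕ → ℝ) (η : ℝ) : Prop :=
  ∀ x, V x = B.C * x - η + min (B.acceptTerm V x) (B.rejectTerm lam V x)

end BaseStation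

end

/-! The proof is by vanishing discount. Departures act on the state as the truncated subtraction `x
- d` with a law of `d` that does not depend on `x` (`sum_depProb_mul`), so monotonicity and
convexity can be checked for each `d` separately. The Bellman operator preserves the class of
monotone convex functions (`seqConvex_bellman`); the minimum of the two action terms stays convex
because their difference is nondecreasing and the mixed inequality `acceptTerm_succ_add_le` holds.
Value iteration and a verification argument then give `discValue_spec`.

Comparing with rejection bounds the relative discounted values uniformly in the discount factor
(`discValue_sub_le`), so compactness yields a value function. Every such limit inherits
monotonicity, convexity and the dynamic programming equation, with `η` the limit of the normalized
discounted values (`IsValueFunction.spec`).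

Convexity makes accept minus reject nondecreasing in the state, whence the thresholds; `t` is finite
because the holding cost outgrows any bounded slope (`exists_rejectTerm_lt_acceptTerm`). Optimality
has two halves: an Abelian comparison bounds every policy from below (`le_avgCost`), and telescoping
the equation bounds the threshold policies from above (`avgCost_le`). -/

/-! ### Expectations under finitely supported discrete laws -/

/-- The expectation of a real function under a discrete law. -/
noncomputable def PMF.expect {β : Type*} (μ : PMF β) (g : β → ℝ) : ℝ :=
  ∑' z, (μ z).toReal * g z

namespace PMF

variable {β γ : Type*}

theorem expect_eq_sum (μ : PMF β) (g : β → ℝ) {s : Finset β} (hs : μ.support ⊆ s) :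
    μ.expect g = ∑ z ∈ s, (μ z).toReal * g z := by
  refine tsum_eq_sum fun z hz => ?_
  have : μ z = 0 := by
    by_contra h
    exact hz (hs ((μ.mem_support_iff z).2 h))
  simp [this]

theorem sum_toReal_eq_one (μ : PMF β) {s : Finset β} (hs : μ.support ⊆ s) :
    ∑ z ∈ s, (μ z).toReal = 1 := by
  rw [← ENNReal.toReal_sum fun z _ => μ.apply_ne_top z]
  have : ∑ z ∈ s, μ z = ∑' z, μ z := by
    refine (tsum_eq_sum fun z hz => ?_).symm
    by_contra h
    exact hz (hs ((μ.mem_support_iff z).2 h))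
  rw [this, μ.tsum_coe, ENNReal.toReal_one]

theorem expect_pure (a : β) (g : β → ℝ) : (PMF.pure a).expect g = g a := by
  rw [expect_eq_sum (s := {a}) _ _ (by simp)]
  simp

theorem expect_const (μ : PMF β) (hμ : μ.support.Finite) (c : ℝ) : μ.expect (fun _ => c) = c := by
  have hs : μ.support ⊆ hμ.toFinset := by simp
  rw [expect_eq_sum _ _ hs, ← Finset.sum_mul, sum_toReal_eq_one _ hs, one_mul]

theorem expect_mono (μ : PMF β) (hμ : μ.support.Finite) {g h : β → ℝ}
    (hgh : ∀ z ∈ μ.support, g z ≤ h z) : μ.expect g ≤ μ.expect h := by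
  have hs : μ.support ⊆ hμ.toFinset := by simp
  rw [expect_eq_sum _ _ hs, expect_eq_sum _ _ hs]
  exact Finset.sum_le_sum fun z hz =>
    mul_le_mul_of_nonneg_left (hgh z (by simpa using hz)) ENNReal.toReal_nonneg

theorem expect_add (μ : PMF β) (hμ : μ.support.Finite) (g h : β → ℝ) :
    μ.expect (fun z => g z + h z) = μ.expect g + μ.expect h := by
  have hs : μ.support ⊆ hμ.toFinset := by simp
  rw [expect_eq_sum _ _ hs, expect_eq_sum _ _ hs, expect_eq_sum _ _ hs, ← Finset.sum_add_distrib]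
  exact Finset.sum_congr rfl fun z _ => mul_add _ _ _

theorem expect_const_mul (μ : PMF β) (c : ℝ) (g : β → ℝ) :
    μ.expect (fun z => c * g z) = c * μ.expect g := by
  unfold expect
  rw [← tsum_mul_left]
  exact tsum_congr fun z => by ring

theorem support_bind_finite (μ : PMF β) (f : β → PMF γ) (hμ : μ.support.Finite)
    (hf : ∀ a ∈ μ.support, (f a).support.Finite) : (μ.bind f).support.Finite := by
  rw [support_bind]
  exact hμ.biUnion hf

theorem expect_bind (μ : PMF β) (f : β → PMF γ) (hμ : μ.support.Finite)
    (hf : ∀ a ∈ μ.support, (f a).support.Finite) (g : γ → ℝ) :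
    (μ.bind f).expect g = μ.expect fun a => (f a).expect g := by
  have hs : μ.support ⊆ hμ.toFinset := by simp
  have hb := support_bind_finite μ f hμ hf
  have ht : (μ.bind f).support ⊆ hb.toFinset := by simp
  rw [expect_eq_sum _ _ hs, expect_eq_sum _ _ ht]
  have h1 : ∀ a ∈ hμ.toFinset, (μ a).toReal * (f a).expect g =
      ∑ b ∈ hb.toFinset, (μ a).toReal * ((f a b).toReal * g b) := by
    intro a ha
    have hsub : (f a).support ⊆ hb.toFinset := by
      intro b hb'
      simp only [Set.Finite.coe_toFinset, mem_support_bind_iff]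
      exact ⟨a, by simpa using ha, hb'⟩
    rw [expect_eq_sum _ _ hsub, Finset.mul_sum]
  rw [Finset.sum_congr rfl h1, Finset.sum_comm]
  refine Finset.sum_congr rfl fun b _ => ?_
  have h2 : (μ.bind f) b = ∑ a ∈ hμ.toFinset, μ a * f a b := by
    rw [bind_apply]
    refine tsum_eq_sum fun a ha => ?_
    have : μ a = 0 := by
      by_contra h
      exact ha (hs ((μ.mem_support_iff a).2 h))
    simp [this]
  rw [h2, ENNReal.toReal_sum fun a _ => ENNReal.mul_ne_top (μ.apply_ne_top _) ((f a).apply_ne_top _),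
    Finset.sum_mul]
  exact Finset.sum_congr rfl fun a _ => by rw [ENNReal.toReal_mul, mul_assoc]

theorem expect_map (μ : PMF β) (f : β → γ) (hμ : μ.support.Finite) (g : γ → ℝ) :
    (μ.map f).expect g = μ.expect (g ∘ f) := by
  rw [← bind_pure_comp, expect_bind _ _ hμ fun a _ => by simp]
  simp [expect_pure, Function.comp_def]

end PMF

/-! ### One-step dynamics and stage costs -/

namespace BaseStation

variable (B : BaseStation)

theorem expect_arrLaw (g : Bool → ℝ) :
    B.arrLaw.expect g = B.p * g true + (1 - B.p) * g false := by
  have h : 0 ≤ 1 - B.p := by linarith [B.p_le_one]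
  rw [PMF.expect_eq_sum (s := Finset.univ) _ _ fun z _ => Finset.mem_coe.2 (Finset.mem_univ z),
    Fintype.sum_bool]
  simp [arrLaw, ENNReal.toReal_ofReal B.p_pos.le, h]

theorem support_depLaw_subset (x : ℕ) :
    (B.depLaw x).support ⊆ Finset.range (min x B.M + 1) := by
  intro d hd
  by_contra h
  exact (PMF.mem_support_iff _ _).1 hd (PMF.ofFinset_apply_of_notMem _ _ (by simpa using h))

theorem expect_depLaw (x : ℕ) (g : ℕ → ℝ) :
    (B.depLaw x).expect g = ∑ d ∈ Finset.range (min x B.M + 1), B.depProb x d * g d := by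
  rw [PMF.expect_eq_sum _ _ (B.support_depLaw_subset x)]
  refine Finset.sum_congr rfl fun d _ => ?_
  rw [depLaw, PMF.ofFinset_apply, ENNReal.toReal_ofReal (B.depProb_nonneg x d)]

theorem support_depLaw_finite (x : ℕ) : (B.depLaw x).support.Finite :=
  (Finset.finite_toSet _).subset (B.support_depLaw_subset x)

theorem support_law_finite (π : Policy) (x₀ n : ℕ) : (B.law π x₀ n).support.Finite := by
  induction n with
  | zero => simp [law]
  | succ n ih =>
    refine PMF.support_bind_finite _ _ ih fun s _ => ?_
    refine PMF.support_bind_finite _ _ (Set.toFinite _) fun u _ => ?_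
    refine PMF.support_bind_finite _ _ (Set.toFinite _) fun a _ => ?_
    exact PMF.support_bind_finite _ _ (B.support_depLaw_finite _) fun d _ => by simp

/-- At most one user arrives per slot. This linear growth is what makes discounted sums converge. -/
theorem state_le_of_mem_support_law (π : Policy) (x₀ n : ℕ) :
    ∀ s ∈ (B.law π x₀ n).support, s.2 ≤ x₀ + n := by
  induction n with
  | zero => simp [law]
  | succ n ih =>
    intro s hs
    simp only [law, PMF.mem_support_bind_iff, PMF.support_pure, Set.mem_singleton_iff] at hs
    obtain ⟨s', hs', u, -, a, -, d, -, rfl⟩ := hs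
    have := ih s' hs'
    dsimp only
    split_ifs <;> omega

/-- The value of a control in a state when the next state is valued by `V`, without the holding
cost of the slot. -/
noncomputable def actionValue (lam : ℝ) (V : ℕ → ℝ) (x : ℕ) (u : Bool) : ℝ :=
  if u then B.acceptTerm V x else B.rejectTerm lam V x

/-- Setting the tax to zero in `actionValue` leaves the bare expectation over the next state. -/
theorem expect_next (V : ℕ → ℝ) (x : ℕ) (u : Bool) :
    (B.arrLaw.expect fun a => (B.depLaw x).expect fun d => V (x - d + if a && u then 1 else 0)) =
      B.actionValue 0 V x u := by
  rw [expect_arrLaw, expect_depLaw, expect_depLaw, Finset.mul_sum, Finset.mul_sum,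
    ← Finset.sum_add_distrib]
  cases u
  · simp only [actionValue, rejectTerm, Bool.and_false, Bool.false_eq_true, if_false, zero_add,
      add_zero]
    exact Finset.sum_congr rfl fun d _ => by ring
  · simp only [actionValue, acceptTerm, Bool.and_true, Bool.false_eq_true, if_false, if_true,
      add_zero]
    exact Finset.sum_congr rfl fun d _ => by ring

theorem actionValue_eq_add (lam : ℝ) (V : ℕ → ℝ) (x : ℕ) (u : Bool) :
    B.actionValue lam V x u = lam * (1 - if u then 1 else 0) + B.actionValue 0 V x u := by
  cases u <;> simp [actionValue, rejectTerm]

theorem expect_law_succ (π : Policy) (x₀ n : ℕ) (V : ℕ → ℝ) :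
    (B.law π x₀ (n + 1)).expect (fun s => V s.2) =
      (B.law π x₀ n).expect fun s => (π s.1 s.2).expect fun u => B.actionValue 0 V s.2 u := by
  have h3 : ∀ (s : List SlotRecord × ℕ) (u a : Bool), ((B.depLaw s.2).bind fun d =>
      PMF.pure ((s.2, u, a, d) :: s.1, s.2 - d + (if a && u then 1 else 0))).support.Finite :=
    fun s u a => PMF.support_bind_finite _ _ (B.support_depLaw_finite _) fun d _ => by simp
  have h2 : ∀ (s : List SlotRecord × ℕ) (u : Bool), (B.arrLaw.bind fun a =>
      (B.depLaw s.2).bind fun d =>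
      PMF.pure ((s.2, u, a, d) :: s.1, s.2 - d + (if a && u then 1 else 0))).support.Finite :=
    fun s u => PMF.support_bind_finite _ _ (Set.toFinite _) fun a _ => h3 s u a
  rw [law, PMF.expect_bind _ _ (B.support_law_finite π x₀ n) fun s _ =>
    PMF.support_bind_finite _ _ (Set.toFinite _) fun u _ => h2 s u]
  congr 1
  funext s
  rw [PMF.expect_bind _ _ (Set.toFinite _) fun u _ => h2 s u]
  congr 1
  funext u
  rw [PMF.expect_bind _ _ (Set.toFinite _) fun a _ => h3 s u a, ← expect_next]
  congr 1
  funext a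
  rw [PMF.expect_bind _ _ (B.support_depLaw_finite _) fun d _ => by simp]
  simp only [PMF.expect_pure]

theorem stageCost_eq_expect (lam : ℝ) (π : Policy) (x₀ n : ℕ) :
    B.stageCost lam π x₀ n = (B.law π x₀ n).expect fun s => (π s.1 s.2).expect fun u =>
      B.C * s.2 + lam * (1 - if u then 1 else 0) := by
  change (B.stateControlLaw π x₀ n).expect
    (fun z => B.C * z.1 + lam * (1 - if z.2 then 1 else 0)) = _
  rw [stateControlLaw, PMF.expect_bind _ _ (B.support_law_finite π x₀ n) fun s _ => Set.Finite.subset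
    (Set.toFinite (Set.range fun u : Bool => (s.2, u))) (by
      rw [PMF.support_map]
      exact Set.image_subset_range _ _)]
  congr 1
  funext s
  rw [PMF.expect_map _ _ (Set.toFinite _)]
  rfl

theorem stageCost_add_expect_law_succ (lam : ℝ) (π : Policy) (x₀ n : ℕ) (W : ℕ → ℝ) :
    B.stageCost lam π x₀ n + (B.law π x₀ (n + 1)).expect (fun s => W s.2) =
      (B.law π x₀ n).expect fun s => (π s.1 s.2).expect fun u =>
        B.C * s.2 + B.actionValue lam W s.2 u := by
  rw [stageCost_eq_expect, expect_law_succ, ← PMF.expect_add _ (B.support_law_finite π x₀ n)]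
  congr 1
  funext s
  rw [← PMF.expect_add _ (Set.toFinite _)]
  congr 1
  funext u
  rw [B.actionValue_eq_add lam]
  ring

/-- One step of verification. Separate functions for the current and the next slot leave room for a
discount factor: `W` is later `α * V`. -/
theorem expect_law_le_stageCost_add {lam : ℝ} {V W : ℕ → ℝ}
    (h : ∀ x u, V x ≤ B.C * x + B.actionValue lam W x u) (π : Policy) (x₀ n : ℕ) :
    (B.law π x₀ n).expect (fun s => V s.2) ≤
      B.stageCost lam π x₀ n + (B.law π x₀ (n + 1)).expect (fun s => W s.2) := by
  rw [stageCost_add_expect_law_succ]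
  refine PMF.expect_mono _ (B.support_law_finite π x₀ n) fun s _ => ?_
  calc V s.2 = (π s.1 s.2).expect fun _ => V s.2 := (PMF.expect_const _ (Set.toFinite _) _).symm
    _ ≤ _ := PMF.expect_mono _ (Set.toFinite _) fun u _ => h s.2 u

theorem expect_law_eq_stageCost_add {lam : ℝ} {V W : ℕ → ℝ} (f : ℕ → Bool)
    (h : ∀ x, V x = B.C * x + B.actionValue lam W x (f x)) (x₀ n : ℕ) :
    (B.law (stationary fun x => PMF.pure (f x)) x₀ n).expect (fun s => V s.2) =
      B.stageCost lam (stationary fun x => PMF.pure (f x)) x₀ n +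
        (B.law (stationary fun x => PMF.pure (f x)) x₀ (n + 1)).expect (fun s => W s.2) := by
  rw [stageCost_add_expect_law_succ]
  congr 1
  funext s
  rw [stationary, PMF.expect_pure, h]

theorem expect_law_zero (π : Policy) (x₀ : ℕ) (V : ℕ → ℝ) :
    (B.law π x₀ 0).expect (fun s => V s.2) = V x₀ := by
  rw [law, PMF.expect_pure]

theorem abs_stageCost_le (lam : ℝ) (π : Policy) (x₀ n : ℕ) :
    |B.stageCost lam π x₀ n| ≤ B.C * (x₀ + n) + |lam| := by
  have key : ∀ s ∈ (B.law π x₀ n).support, ∀ u : Bool,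
      |B.C * s.2 + lam * (1 - if u then 1 else 0)| ≤ B.C * (x₀ + n) + |lam| := by
    intro s hs u
    have h1 : (s.2 : ℝ) ≤ x₀ + n := by exact_mod_cast B.state_le_of_mem_support_law π x₀ n s hs
    have h2 := mul_le_mul_of_nonneg_left h1 B.C_pos.le
    have h3 : 0 ≤ B.C * s.2 := mul_nonneg B.C_pos.le (Nat.cast_nonneg _)
    refine (abs_add_le _ _).trans (add_le_add ((abs_of_nonneg h3).trans_le h2) ?_)
    cases u <;> simp
  have hf := B.support_law_finite π x₀ n
  rw [stageCost_eq_expect, abs_le]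
  constructor
  · rw [← PMF.expect_const _ hf (-(B.C * (x₀ + n) + |lam|))]
    refine PMF.expect_mono _ hf fun s hs => ?_
    rw [← PMF.expect_const (π s.1 s.2) (Set.toFinite _) (-(B.C * (x₀ + n) + |lam|))]
    exact PMF.expect_mono _ (Set.toFinite _) fun u _ => (abs_le.1 (key s hs u)).1
  · rw [← PMF.expect_const _ hf (B.C * (x₀ + n) + |lam|)]
    refine PMF.expect_mono _ hf fun s hs => ?_
    rw [← PMF.expect_const (π s.1 s.2) (Set.toFinite _) (B.C * (x₀ + n) + |lam|)]
    exact PMF.expect_mono _ (Set.toFinite _) fun u _ => (abs_le.1 (key s hs u)).2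

/-! ### The service operator: monotonicity and convexity -/

/-- The expectation of `g` at the number of users left in a slot that starts with `x` users. -/
noncomputable def afterService (g : ℕ → ℝ) (x : ℕ) : ℝ :=
  ∑ d ∈ Finset.range (B.M + 1), B.serviceProb d * g (x - d)

/-- The lumped mass at `min x M` collects all `d` that empty the station, or `d = M` alone, and
natural subtraction truncates in the same way. -/
theorem sum_depProb_mul (g : ℕ → ℝ) (x : ℕ) :
    ∑ d ∈ Finset.range (min x B.M + 1), B.depProb x d * g (x - d) = B.afterService g x := by
  rw [Finset.sum_range_succ, afterService,
    ← Finset.sum_range_add_sum_Ico _ (show min x B.M ≤ B.M + 1 by omega),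
    Finset.Ico_add_one_right_eq_Icc]
  congr 1
  · exact Finset.sum_congr rfl fun d hd => by simp only [depProb, if_pos (Finset.mem_range.1 hd)]
  · rw [depProb, if_neg (lt_irrefl _), if_pos rfl, Finset.sum_mul]
    refine Finset.sum_congr rfl fun d hd => ?_
    rw [Finset.mem_Icc] at hd
    rw [show x - min x B.M = x - d by omega]

theorem acceptTerm_eq (V : ℕ → ℝ) (x : ℕ) :
    B.acceptTerm V x = B.afterService (fun y => B.p * V (y + 1) + (1 - B.p) * V y) x :=
  B.sum_depProb_mul (fun y => B.p * V (y + 1) + (1 - B.p) * V y) x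

theorem rejectTerm_eq (lam : ℝ) (V : ℕ → ℝ) (x : ℕ) :
    B.rejectTerm lam V x = lam + B.afterService V x := by
  rw [rejectTerm, sum_depProb_mul]

theorem afterService_le_afterService {g h : ℕ → ℝ} {x y : ℕ}
    (H : ∀ d, g (x - d) ≤ h (y - d)) : B.afterService g x ≤ B.afterService h y :=
  Finset.sum_le_sum fun d _ => mul_le_mul_of_nonneg_left (H d) (B.serviceProb_nonneg d)

theorem afterService_const (c : ℝ) (x : ℕ) : B.afterService (fun _ => c) x = c := by
  rw [afterService, ← Finset.sum_mul, sum_serviceProb, one_mul]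

theorem afterService_add (g h : ℕ → ℝ) (x : ℕ) :
    B.afterService (fun y => g y + h y) x = B.afterService g x + B.afterService h x := by
  simp only [afterService, ← Finset.sum_add_distrib, mul_add]

theorem afterService_const_mul (c : ℝ) (g : ℕ → ℝ) (x : ℕ) :
    B.afterService (fun y => c * g y) x = c * B.afterService g x := by
  rw [afterService, afterService, Finset.mul_sum]
  exact Finset.sum_congr rfl fun d _ => by ring

theorem tendsto_afterService {ι : Type*} {l : Filter ι} {g : ι → ℕ → ℝ} {h : ℕ → ℝ}
    (H : ∀ x, Tendsto (fun i => g i x) l (𝓝 (h x))) (x : ℕ) :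
    Tendsto (fun i => B.afterService (g i) x) l (𝓝 (B.afterService h x)) :=
  tendsto_finsetSum _ fun d _ => (H (x - d)).const_mul _

/-- Convexity of a real sequence. -/
def SeqConvex (g : ℕ → ℝ) : Prop := ∀ x, g (x + 1) + g (x + 1) ≤ g x + g (x + 2)

theorem monotone_afterService {g : ℕ → ℝ} (hg : Monotone g) : Monotone (B.afterService g) :=
  fun _ _ hxy => B.afterService_le_afterService fun _ => hg (by omega)

/-- The map `x ↦ x - d` is itself convex, with a kink where the station empties; monotonicity of `g`
is needed at that kink. -/
theorem seqConvex_afterService {g : ℕ → ℝ} (hg : Monotone g) (hc : SeqConvex g) :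
    SeqConvex (B.afterService g) := by
  intro x
  simp only [afterService, ← Finset.sum_add_distrib, ← mul_add]
  refine Finset.sum_le_sum fun d _ => mul_le_mul_of_nonneg_left ?_ (B.serviceProb_nonneg d)
  rcases le_or_gt d x with h | h
  · have := hc (x - d)
    rwa [show x + 1 - d = x - d + 1 by omega, show x + 2 - d = x - d + 2 by omega]
  · rw [show x + 1 - d = 0 by omega, show x - d = 0 by omega]
    exact add_le_add le_rfl (hg (Nat.zero_le _))

theorem monotone_arrival {V : ℕ → ℝ} (hV : Monotone V) :
    Monotone fun y => B.p * V (y + 1) + (1 - B.p) * V y := by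
  intro x y hxy
  have h1 := mul_le_mul_of_nonneg_left (hV (add_le_add_left hxy 1)) B.p_pos.le
  have h2 := mul_le_mul_of_nonneg_left (hV hxy) (sub_nonneg.2 B.p_le_one)
  exact add_le_add h1 h2

theorem seqConvex_arrival {V : ℕ → ℝ} (hc : SeqConvex V) :
    SeqConvex fun y => B.p * V (y + 1) + (1 - B.p) * V y := by
  intro x
  have h1 := mul_le_mul_of_nonneg_left (hc (x + 1)) B.p_pos.le
  have h2 := mul_le_mul_of_nonneg_left (hc x) (sub_nonneg.2 B.p_le_one)
  dsimp only
  linarith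

/-- The expected increase of `V` caused by accepting. -/
theorem acceptTerm_sub_rejectTerm (lam : ℝ) (V : ℕ → ℝ) (x : ℕ) :
    B.acceptTerm V x - B.rejectTerm lam V x =
      B.p * B.afterService (fun y => V (y + 1) - V y) x - lam := by
  rw [acceptTerm_eq, rejectTerm_eq, ← afterService_const_mul]
  have : (fun y => B.p * V (y + 1) + (1 - B.p) * V y) =
      fun y => B.p * (V (y + 1) - V y) + V y := by
    funext y
    ring
  rw [this, afterService_add]
  ring

theorem SeqConvex.monotone_diff {V : ℕ → ℝ} (hc : SeqConvex V) :
    Monotone fun y => V (y + 1) - V y :=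
  monotone_nat_of_le_succ fun x => by linarith [hc x]

/-- Increments of a convex function are nondecreasing and service preserves this. It is the source
of the threshold structure. -/
theorem monotone_acceptTerm_sub_rejectTerm (lam : ℝ) {V : ℕ → ℝ} (hc : SeqConvex V) :
    Monotone fun x => B.acceptTerm V x - B.rejectTerm lam V x := by
  intro x y hxy
  simp only [acceptTerm_sub_rejectTerm]
  have := mul_le_mul_of_nonneg_left (B.monotone_afterService hc.monotone_diff hxy) B.p_pos.le
  linarith

/-- For fixed `d ≤ x` the gap between the two sides is `1 - p` times a second difference of `V`. It
settles convexity of the minimum where acceptance at `x` meets rejection at `x + 2`. -/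
theorem acceptTerm_succ_add_le (lam : ℝ) {V : ℕ → ℝ} (hV : Monotone V) (hc : SeqConvex V) (x : ℕ) :
    B.acceptTerm V (x + 1) + B.rejectTerm lam V (x + 1) ≤
      B.acceptTerm V x + B.rejectTerm lam V (x + 2) := by
  have key : B.afterService (fun y => B.p * V (y + 1) + (1 - B.p) * V y) (x + 1) +
      B.afterService V (x + 1) ≤ B.afterService (fun y => B.p * V (y + 1) + (1 - B.p) * V y) x +
      B.afterService V (x + 2) := by
    simp only [afterService, ← Finset.sum_add_distrib, ← mul_add]
    refine Finset.sum_le_sum fun d _ => mul_le_mul_of_nonneg_left ?_ (B.serviceProb_nonneg d)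
    rcases le_or_gt d x with h | h
    · have h1 := mul_le_mul_of_nonneg_left (hc (x - d)) (sub_nonneg.2 B.p_le_one)
      rw [show x + 1 - d = x - d + 1 by omega, show x + 2 - d = x - d + 2 by omega]
      linarith
    · rw [show x + 1 - d = 0 by omega, show x - d = 0 by omega]
      exact add_le_add le_rfl (hV (Nat.zero_le _))
  rw [acceptTerm_eq, acceptTerm_eq, rejectTerm_eq, rejectTerm_eq]
  linarith

theorem monotone_acceptTerm {V : ℕ → ℝ} (hV : Monotone V) : Monotone (B.acceptTerm V) := by
  rw [show B.acceptTerm V = _ from funext (B.acceptTerm_eq V)]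
  exact B.monotone_afterService (B.monotone_arrival hV)

theorem monotone_rejectTerm (lam : ℝ) {V : ℕ → ℝ} (hV : Monotone V) :
    Monotone (B.rejectTerm lam V) := by
  rw [show B.rejectTerm lam V = _ from funext (B.rejectTerm_eq lam V)]
  exact (B.monotone_afterService hV).const_add lam

/-! ### The Bellman operator -/

/-- The right-hand side of the dynamic programming equation. -/
noncomputable def bellman (lam : ℝ) (V : ℕ → ℝ) (x : ℕ) : ℝ :=
  B.C * x + min (B.acceptTerm V x) (B.rejectTerm lam V x)

theorem bellman_le (lam : ℝ) (V : ℕ → ℝ) (x : ℕ) (u : Bool) :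
    B.bellman lam V x ≤ B.C * x + B.actionValue lam V x u := by
  cases u
  · exact add_le_add le_rfl (min_le_right _ _)
  · exact add_le_add le_rfl (min_le_left _ _)

theorem bellman_eq_decide (lam : ℝ) (V : ℕ → ℝ) (x : ℕ) :
    B.bellman lam V x = B.C * x +
      B.actionValue lam V x (decide (B.acceptTerm V x ≤ B.rejectTerm lam V x)) := by
  by_cases h : B.acceptTerm V x ≤ B.rejectTerm lam V x
  · simp [bellman, actionValue, h]
  · simp [bellman, actionValue, h, (not_le.1 h).le]

theorem monotone_bellman (lam : ℝ) {V : ℕ → ℝ} (hV : Monotone V) :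
    Monotone (B.bellman lam V) := fun _ _ hxy =>
  add_le_add (mul_le_mul_of_nonneg_left (Nat.cast_le.2 hxy) B.C_pos.le)
    (min_le_min (B.monotone_acceptTerm hV hxy) (B.monotone_rejectTerm lam hV hxy))

theorem seqConvex_bellman (lam : ℝ) {V : ℕ → ℝ} (hV : Monotone V) (hc : SeqConvex V) :
    SeqConvex (B.bellman lam V) := by
  intro x
  have ha : B.acceptTerm V (x + 1) + B.acceptTerm V (x + 1) ≤
      B.acceptTerm V x + B.acceptTerm V (x + 2) := by
    rw [show B.acceptTerm V = _ from funext (B.acceptTerm_eq V)]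
    exact B.seqConvex_afterService (B.monotone_arrival hV) (B.seqConvex_arrival hc) x
  have hb : B.rejectTerm lam V (x + 1) + B.rejectTerm lam V (x + 1) ≤
      B.rejectTerm lam V x + B.rejectTerm lam V (x + 2) := by
    simp only [rejectTerm_eq]
    linarith [B.seqConvex_afterService hV hc x]
  have hab := B.acceptTerm_succ_add_le lam hV hc x
  have hd : B.acceptTerm V x - B.rejectTerm lam V x ≤
      B.acceptTerm V (x + 2) - B.rejectTerm lam V (x + 2) :=
    B.monotone_acceptTerm_sub_rejectTerm lam hc (Nat.le_add_right x 2)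
  have h1 := min_le_left (B.acceptTerm V (x + 1)) (B.rejectTerm lam V (x + 1))
  have h2 := min_le_right (B.acceptTerm V (x + 1)) (B.rejectTerm lam V (x + 1))
  unfold bellman
  push_cast
  rcases min_choice (B.acceptTerm V x) (B.rejectTerm lam V x) with h | h <;>
    rcases min_choice (B.acceptTerm V (x + 2)) (B.rejectTerm lam V (x + 2)) with h' | h'
  · linarith
  · linarith
  -- Rejecting is minimal at `x`, so by `hd` the reject term is also at most the accept term at `x +
  -- 2`, and convexity of the reject term suffices.
  · have := min_eq_right_iff.1 h
    linarith
  · linarith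

theorem bellman_mono (lam : ℝ) {V W : ℕ → ℝ} (h : ∀ x, V x ≤ W x) (x : ℕ) :
    B.bellman lam V x ≤ B.bellman lam W x := by
  rw [bellman, bellman, acceptTerm_eq, acceptTerm_eq, rejectTerm_eq, rejectTerm_eq]
  refine add_le_add le_rfl (min_le_min ?_ (add_le_add le_rfl ?_))
  · exact B.afterService_le_afterService fun d => add_le_add
      (mul_le_mul_of_nonneg_left (h _) B.p_pos.le)
      (mul_le_mul_of_nonneg_left (h _) (sub_nonneg.2 B.p_le_one))
  · exact B.afterService_le_afterService fun d => h _

theorem tendsto_bellman (lam : ℝ) {ι : Type*} {l : Filter ι} {g : ι → ℕ → ℝ} {h : ℕ → ℝ}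
    (H : ∀ x, Tendsto (fun i => g i x) l (𝓝 (h x))) (x : ℕ) :
    Tendsto (fun i => B.bellman lam (g i) x) l (𝓝 (B.bellman lam h x)) := by
  simp only [bellman, acceptTerm_eq, rejectTerm_eq]
  refine tendsto_const_nhds.add (Tendsto.min ?_ (tendsto_const_nhds.add ?_))
  · exact B.tendsto_afterService
      (fun y => ((H (y + 1)).const_mul B.p).add ((H y).const_mul (1 - B.p))) x
  · exact B.tendsto_afterService H x

theorem bellman_sub_const (lam : ℝ) (V : ℕ → ℝ) (c : ℝ) (x : ℕ) :
    B.bellman lam (fun y => V y - c) x = B.bellman lam V x - c := by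
  have h1 : B.acceptTerm (fun y => V y - c) x = B.acceptTerm V x - c := by
    have : (fun y => B.p * (V (y + 1) - c) + (1 - B.p) * (V y - c)) =
      fun y => (B.p * V (y + 1) + (1 - B.p) * V y) + -c := by
      funext y
      ring
    rw [acceptTerm_eq, acceptTerm_eq, this, afterService_add, afterService_const]
    ring
  have h2 : B.rejectTerm lam (fun y => V y - c) x = B.rejectTerm lam V x - c := by
    rw [rejectTerm_eq, rejectTerm_eq, show (fun y => V y - c) = fun y => V y + -c from rfl,
      afterService_add, afterService_const]
    ring
  rw [bellman, bellman, h1, h2, min_sub_sub_right]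
  ring

theorem le_bellman_const (lam c : ℝ) (x : ℕ) : c - |lam| ≤ B.bellman lam (fun _ => c) x := by
  rw [bellman, acceptTerm_eq, rejectTerm_eq, afterService_const, afterService_const]
  have h1 : 0 ≤ B.C * x := mul_nonneg B.C_pos.le (Nat.cast_nonneg _)
  have h2 : c - |lam| ≤ min (B.p * c + (1 - B.p) * c) (lam + c) :=
    le_min (by linarith [abs_nonneg lam]) (by linarith [neg_abs_le lam])
  linarith

theorem bellman_le_reject (lam : ℝ) (V : ℕ → ℝ) (x : ℕ) :
    B.bellman lam V x ≤ B.C * x + |lam| + B.afterService V x := by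
  rw [bellman, rejectTerm_eq]
  linarith [min_le_right (B.acceptTerm V x) (lam + B.afterService V x), le_abs_self lam]

/-- An unjammed slot has positive probability and offers a departure with positive probability,
since `r' > 0`. -/
theorem serviceProb_zero_lt_one : B.serviceProb 0 < 1 := by
  have h1 : (1 - B.r) ^ B.M ≤ 1 :=
    pow_le_one₀ (by linarith [B.r_lt_r', B.r'_le_one]) (by linarith [B.r_nonneg])
  have h2 : (1 - B.r') ^ B.M < 1 :=
    pow_lt_one₀ (by linarith [B.r'_le_one]) (by linarith [B.r_nonneg, B.r_lt_r'])
      (by have := B.one_le_M; omega)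
  have h3 := mul_le_mul_of_nonneg_right h1 B.q_pos.le
  have h4 := mul_lt_mul_of_pos_right h2 (sub_pos.2 B.q_lt_one)
  simp only [serviceProb, Nat.choose_zero_right, pow_zero, Nat.sub_zero, Nat.cast_one, one_mul]
  linarith

/-- Every `d ≥ 1` leaves at most `x` of the `x + 1` users. -/
theorem afterService_succ_le {g : ℕ → ℝ} (hg : Monotone g) (x : ℕ) :
    B.afterService g (x + 1) ≤ B.serviceProb 0 * g (x + 1) + (1 - B.serviceProb 0) * g x := by
  have h := B.sum_serviceProb
  rw [Finset.sum_range_succ'] at h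
  rw [afterService, Finset.sum_range_succ', ← h, add_sub_cancel_right, add_comm, Finset.sum_mul]
  refine add_le_add le_rfl (Finset.sum_le_sum fun d _ => ?_)
  exact mul_le_mul_of_nonneg_left (hg (by omega)) (B.serviceProb_nonneg _)

theorem seqConvex_const_mul {g : ℕ → ℝ} {c : ℝ} (h0 : 0 ≤ c) (hc : SeqConvex g) :
    SeqConvex fun y => c * g y := fun x => by
  have := mul_le_mul_of_nonneg_left (hc x) h0
  dsimp only
  linarith

theorem seqConvex_of_tendsto {ι : Type*} {l : Filter ι} [l.NeBot] {g : ι → ℕ → ℝ} {h : ℕ → ℝ}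
    (hg : ∀ i, SeqConvex (g i)) (H : ∀ x, Tendsto (fun i => g i x) l (𝓝 (h x))) :
    SeqConvex h := fun x =>
  le_of_tendsto_of_tendsto' ((H (x + 1)).add (H (x + 1))) ((H x).add (H (x + 2)))
    fun i => hg i x

theorem monotone_of_tendsto {ι : Type*} {l : Filter ι} [l.NeBot] {g : ι → ℕ → ℝ} {h : ℕ → ℝ}
    (hg : ∀ i, Monotone (g i)) (H : ∀ x, Tendsto (fun i => g i x) l (𝓝 (h x))) :
    Monotone h := fun x y hxy =>
  le_of_tendsto_of_tendsto' (H x) (H y) fun i => hg i hxy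

/-! ### The discounted problem -/

/-- The discounted dynamic programming equation has a monotone convex solution of at most linear
growth. -/
theorem exists_discounted_solution (lam : ℝ) {α : ℝ} (h0 : 0 < α) (h1 : α < 1) :
    ∃ V : ℕ → ℝ, Monotone V ∧ SeqConvex V ∧ (∀ x, V x = B.bellman lam (fun y => α * V y) x) ∧
      (∀ x, -|lam| ≤ (1 - α) * V x) ∧ ∀ x, (1 - α) * V x ≤ B.C * x + |lam| := by
  have hα : 0 < 1 - α := sub_pos.2 h1
  have hne := hα.ne'
  set T : (ℕ → ℝ) → ℕ → ℝ := fun V => B.bellman lam fun y => α * V y with hT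
  have T_mono : ∀ {V W : ℕ → ℝ}, (∀ x, V x ≤ W x) → ∀ x, T V x ≤ T W x := fun h x =>
    B.bellman_mono lam (fun y => mul_le_mul_of_nonneg_left (h y) h0.le) x
  -- Value iteration increases from the subsolution `L` and stays below the supersolution `U`. `U x`
  -- is the discounted total of paying `C * x + |lam|` in every slot, which dominates always
  -- rejecting.
  set L : ℕ → ℝ := fun _ => -|lam| / (1 - α) with hL
  set U : ℕ → ℝ := fun x => (B.C * x + |lam|) / (1 - α) with hU
  have hLT : ∀ x, L x ≤ T L x := fun x => by
    refine le_trans (le_of_eq ?_) (B.le_bellman_const lam (α * (-|lam| / (1 - α))) x)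
    simp only [hL]
    field_simp
    ring
  have hUmono : Monotone U := fun x y hxy => by
    refine div_le_div_of_nonneg_right ?_ hα.le
    have := mul_le_mul_of_nonneg_left (Nat.cast_le (α := ℝ).2 hxy) B.C_pos.le
    linarith
  have hTU : ∀ x, T U x ≤ U x := fun x => by
    have h2 : B.afterService (fun y => α * U y) x ≤ α * U x := by
      rw [← B.afterService_const (α * U x) x]
      exact B.afterService_le_afterService fun d =>
        mul_le_mul_of_nonneg_left (hUmono (Nat.sub_le _ _)) h0.le
    refine (B.bellman_le_reject lam _ x).trans ((add_le_add le_rfl h2).trans (le_of_eq ?_))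
    simp only [hU]
    field_simp
    ring
  have hLU : ∀ x, L x ≤ U x := fun x => by
    refine div_le_div_of_nonneg_right ?_ hα.le
    have := mul_nonneg B.C_pos.le (Nat.cast_nonneg (α := ℝ) x)
    linarith [abs_nonneg lam]
  set v : ℕ → ℕ → ℝ := fun n => T^[n] L with hv
  have v_succ : ∀ n, v (n + 1) = T (v n) := fun n => Function.iterate_succ_apply' T n L
  have v_le_succ : ∀ n x, v n x ≤ v (n + 1) x := by
    intro n
    induction n with
    | zero => exact hLT
    | succ n ih =>
      intro x
      rw [v_succ, v_succ (n + 1)]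
      exact T_mono ih x
  have v_le : ∀ n x, v n x ≤ U x := by
    intro n
    induction n with
    | zero => exact hLU
    | succ n ih =>
      intro x
      rw [v_succ]
      exact (T_mono ih x).trans (hTU x)
  have v_good : ∀ n, Monotone (v n) ∧ SeqConvex (v n) := by
    intro n
    induction n with
    | zero => exact ⟨fun _ _ _ => le_rfl, fun _ => le_rfl⟩
    | succ n ih =>
      rw [v_succ]
      have hm : Monotone fun y => α * v n y := fun x y hxy =>
        mul_le_mul_of_nonneg_left (ih.1 hxy) h0.le
      exact ⟨B.monotone_bellman lam hm,
        B.seqConvex_bellman lam hm (seqConvex_const_mul h0.le ih.2)⟩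
  have v_mono : ∀ x, Monotone fun n => v n x := fun x => monotone_nat_of_le_succ fun n =>
    v_le_succ n x
  have v_bdd : ∀ x, BddAbove (Set.range fun n => v n x) := fun x =>
    ⟨U x, by rintro _ ⟨n, rfl⟩; exact v_le n x⟩
  have hlim : ∀ x, Tendsto (fun n => v n x) atTop (𝓝 (⨆ n, v n x)) := fun x =>
    tendsto_atTop_ciSup (v_mono x) (v_bdd x)
  refine ⟨fun x => ⨆ n, v n x, monotone_of_tendsto (fun n => (v_good n).1) hlim,
    seqConvex_of_tendsto (fun n => (v_good n).2) hlim, fun x => ?_, fun x => ?_, fun x => ?_⟩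
  · refine tendsto_nhds_unique ((tendsto_add_atTop_iff_nat 1).2 (hlim x)) ?_
    simp only [v_succ]
    exact B.tendsto_bellman lam (fun y => (hlim y).const_mul α) x
  · have : -|lam| / (1 - α) ≤ ⨆ n, v n x := le_ciSup (v_bdd x) 0
    rw [div_le_iff₀ hα] at this
    linarith
  · have : (⨆ n, v n x) ≤ (B.C * x + |lam|) / (1 - α) := ciSup_le fun n => v_le n x
    rw [le_div_iff₀ hα] at this
    linarith

theorem summable_discounted_linear {α : ℝ} (h0 : 0 < α) (h1 : α < 1) (a b : ℝ) :
    Summable fun n : ℕ => α ^ n * (a * n + b) := by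
  have hα : ‖α‖ < 1 := by rwa [Real.norm_of_nonneg h0.le]
  have hs := ((summable_pow_mul_geometric_of_norm_lt_one 1 hα).mul_left a).add
    ((summable_geometric_of_norm_lt_one hα).mul_left b)
  exact hs.congr fun n => by simp only [pow_one]; ring

theorem summable_discounted_stageCost (lam : ℝ) {α : ℝ} (h0 : 0 < α) (h1 : α < 1) (π : Policy)
    (x₀ : ℕ) : Summable fun n => α ^ n * B.stageCost lam π x₀ n := by
  refine Summable.of_norm_bounded
    (summable_discounted_linear h0 h1 B.C (B.C * x₀ + |lam|)) fun n => ?_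
  rw [norm_mul, Real.norm_of_nonneg (pow_nonneg h0.le n)]
  refine mul_le_mul_of_nonneg_left ?_ (pow_nonneg h0.le n)
  linarith [B.abs_stageCost_le lam π x₀ n, Real.norm_eq_abs (B.stageCost lam π x₀ n)]

theorem tendsto_sum_discounted_stageCost (lam : ℝ) {α : ℝ} (h0 : 0 < α) (h1 : α < 1) (π : Policy)
    (x₀ : ℕ) : Tendsto (fun N => ∑ n ∈ Finset.range N, α ^ n * B.stageCost lam π x₀ n) atTop
      (𝓝 (B.discCost lam α π x₀)) :=
  (B.summable_discounted_stageCost lam h0 h1 π x₀).hasSum.tendsto_sum_nat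

theorem tendsto_discounted_expect_law {α : ℝ} (h0 : 0 < α) (h1 : α < 1) {V : ℕ → ℝ} {a b : ℝ}
    (ha : 0 ≤ a) (hV : ∀ x, |V x| ≤ a * x + b) (π : Policy) (x₀ : ℕ) :
    Tendsto (fun N => α ^ N * (B.law π x₀ N).expect fun s => V s.2) atTop (𝓝 0) := by
  have hf := fun N => B.support_law_finite π x₀ N
  have hbound : ∀ N, |(B.law π x₀ N).expect fun s => V s.2| ≤ a * N + (a * x₀ + b) := by
    intro N
    have key : ∀ s ∈ (B.law π x₀ N).support, |V s.2| ≤ a * N + (a * x₀ + b) := fun s hs => by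
      have h2 : (s.2 : ℝ) ≤ x₀ + N := by exact_mod_cast B.state_le_of_mem_support_law π x₀ N s hs
      have := mul_le_mul_of_nonneg_left h2 ha
      linarith [hV s.2]
    rw [abs_le]
    constructor
    · rw [← PMF.expect_const _ (hf N) (-(a * N + (a * x₀ + b)))]
      exact PMF.expect_mono _ (hf N) fun s hs => (abs_le.1 (key s hs)).1
    · rw [← PMF.expect_const _ (hf N) (a * N + (a * x₀ + b))]
      exact PMF.expect_mono _ (hf N) fun s hs => (abs_le.1 (key s hs)).2
  refine squeeze_zero_norm (fun N => ?_)
    (summable_discounted_linear h0 h1 a (a * x₀ + b)).tendsto_atTop_zero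
  rw [norm_mul, Real.norm_of_nonneg (pow_nonneg h0.le N)]
  exact mul_le_mul_of_nonneg_left (hbound N) (pow_nonneg h0.le N)

/-- A solution of linear growth of the discounted dynamic programming equation bounds the
discounted cost of every policy from below. -/
theorem le_discCost {lam α : ℝ} (h0 : 0 < α) (h1 : α < 1) {V : ℕ → ℝ} {a b : ℝ} (ha : 0 ≤ a)
    (hV : ∀ x, |V x| ≤ a * x + b) (hfix : ∀ x, V x = B.bellman lam (fun y => α * V y) x)
    (π : Policy) (x₀ : ℕ) : V x₀ ≤ B.discCost lam α π x₀ := by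
  have step : ∀ N, V x₀ ≤ ∑ n ∈ Finset.range N, α ^ n * B.stageCost lam π x₀ n +
      α ^ N * (B.law π x₀ N).expect fun s => V s.2 := by
    intro N
    induction N with
    | zero => simp [expect_law_zero]
    | succ N ih =>
      have h := B.expect_law_le_stageCost_add
        (fun x u => (hfix x).trans_le (B.bellman_le lam _ x u)) π x₀ N
      rw [PMF.expect_const_mul] at h
      have := mul_le_mul_of_nonneg_left h (pow_nonneg h0.le N)
      rw [Finset.sum_range_succ, pow_succ]
      linarith
  have hlim := (B.tendsto_sum_discounted_stageCost lam h0 h1 π x₀).add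
    (B.tendsto_discounted_expect_law h0 h1 ha hV π x₀)
  rw [add_zero] at hlim
  exact ge_of_tendsto' hlim step

/-- The policy that is greedy for `α * V` turns each inequality of the verification argument into an
equality. -/
theorem exists_discCost_eq {lam α : ℝ} (h0 : 0 < α) (h1 : α < 1) {V : ℕ → ℝ} {a b : ℝ}
    (ha : 0 ≤ a) (hV : ∀ x, |V x| ≤ a * x + b)
    (hfix : ∀ x, V x = B.bellman lam (fun y => α * V y) x) :
    ∃ f : ℕ → PMF Bool, ∀ x₀, B.discCost lam α (stationary f) x₀ = V x₀ := by
  set W : ℕ → ℝ := fun y => α * V y with hW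
  set u : ℕ → Bool := fun x => decide (B.acceptTerm W x ≤ B.rejectTerm lam W x) with hu
  refine ⟨fun x => PMF.pure (u x), fun x₀ => ?_⟩
  set π : Policy := stationary fun x => PMF.pure (u x) with hπ
  have step : ∀ N, ∑ n ∈ Finset.range N, α ^ n * B.stageCost lam π x₀ n +
      α ^ N * (B.law π x₀ N).expect (fun s => V s.2) = V x₀ := by
    intro N
    induction N with
    | zero => simp [expect_law_zero]
    | succ N ih =>
      have h := B.expect_law_eq_stageCost_add u
        (fun x => (hfix x).trans (B.bellman_eq_decide lam W x)) x₀ N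
      rw [hW, PMF.expect_const_mul] at h
      rw [← ih, h, Finset.sum_range_succ, pow_succ]
      ring
  have hlim := (B.tendsto_sum_discounted_stageCost lam h0 h1 π x₀).add
    (B.tendsto_discounted_expect_law h0 h1 ha hV π x₀)
  rw [add_zero] at hlim
  exact tendsto_nhds_unique hlim (by simp only [step]; exact tendsto_const_nhds)

/-- The value function of the discounted problem solves the discounted dynamic programming
equation, is monotone and convex, and bounds the discounted cost of every policy. -/
theorem discValue_spec (lam : ℝ) {α : ℝ} (h0 : 0 < α) (h1 : α < 1) :
    Monotone (B.discValue lam α) ∧ SeqConvex (B.discValue lam α) ∧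
      (∀ x, B.discValue lam α x = B.bellman lam (fun y => α * B.discValue lam α y) x) ∧
      (∀ x, -|lam| ≤ (1 - α) * B.discValue lam α x) ∧
      ∀ π x, B.discValue lam α x ≤ B.discCost lam α π x := by
  obtain ⟨V, hm, hc, hfix, hlow, hup⟩ := B.exists_discounted_solution lam h0 h1
  have hα : 0 < 1 - α := sub_pos.2 h1
  have hV : ∀ x, |V x| ≤ B.C / (1 - α) * x + |lam| / (1 - α) := by
    intro x
    have h2 := mul_nonneg B.C_pos.le (Nat.cast_nonneg (α := ℝ) x)
    rw [div_mul_eq_mul_div, ← add_div, le_div_iff₀ hα, mul_comm, ← abs_of_pos hα, ← abs_mul,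
      abs_le]
    exact ⟨by linarith [hlow x], hup x⟩
  have ha : 0 ≤ B.C / (1 - α) := div_nonneg B.C_pos.le hα.le
  have hle := B.le_discCost h0 h1 ha hV hfix
  obtain ⟨f, hf⟩ := B.exists_discCost_eq h0 h1 ha hV hfix
  have hval : B.discValue lam α = V := by
    funext x
    refine le_antisymm ?_ (le_ciInf fun g => hle (stationary g) x)
    rw [← hf x]
    exact ciInf_le (f := fun g => B.discCost lam α (stationary g) x)
      ⟨V x, by rintro _ ⟨g, rfl⟩; exact hle (stationary g) x⟩ f
  rw [hval]
  exact ⟨hm, hc, hfix, hlow, hle⟩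

/-! ### The vanishing-discount limit -/

/-- The discounted dynamic programming equation for the relative values. -/
theorem discValue_sub_eq (lam : ℝ) {α : ℝ} (h0 : 0 < α) (h1 : α < 1) (x : ℕ) :
    B.discValue lam α x - B.discValue lam α 0 =
      B.bellman lam (fun y => α * (B.discValue lam α y - B.discValue lam α 0)) x -
        (1 - α) * B.discValue lam α 0 := by
  have hfix := (B.discValue_spec lam h0 h1).2.2.1 x
  simp only [mul_sub]
  rw [bellman_sub_const, ← hfix]
  ring

/-- The bound is free of `α`. Rejecting at `x + 1` costs at most `C * (x + 1) + |lam|`, the term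
`-(1 - α) * V^α 0` adds at most `|lam|`, and a departure that brings the state to at most `x` has
probability at least `1 - serviceProb 0`; solving for the increment gives each summand. -/
theorem discValue_sub_le (lam : ℝ) {α : ℝ} (h0 : 0 < α) (h1 : α < 1) (x : ℕ) :
    B.discValue lam α x - B.discValue lam α 0 ≤
      ∑ i ∈ Finset.range x, (B.C * (i + 1) + 2 * |lam|) / (1 - B.serviceProb 0) := by
  obtain ⟨hm, -, -, hlow, -⟩ := B.discValue_spec lam h0 h1
  set h : ℕ → ℝ := fun y => B.discValue lam α y - B.discValue lam α 0 with hh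
  have hmono : Monotone h := fun _ _ hxy => sub_le_sub_right (hm hxy) _
  have hnonneg : ∀ y, 0 ≤ h y := fun y => sub_nonneg.2 (hm (Nat.zero_le y))
  have hP : 0 < 1 - B.serviceProb 0 := sub_pos.2 B.serviceProb_zero_lt_one
  change h x ≤ _
  induction x with
  | zero => simp [hh]
  | succ x ih =>
    rw [Finset.sum_range_succ]
    suffices H : h (x + 1) - h x ≤ (B.C * (x + 1) + 2 * |lam|) / (1 - B.serviceProb 0) by linarith
    rw [le_div_iff₀ hP]
    have e1 : h (x + 1) = _ := B.discValue_sub_eq lam h0 h1 (x + 1)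
    have e2 := B.bellman_le_reject lam (fun y => α * h y) (x + 1)
    have e3 : B.afterService (fun y => α * h y) (x + 1) ≤ B.afterService h (x + 1) :=
      B.afterService_le_afterService fun d => mul_le_of_le_one_left (hnonneg _) h1.le
    have e4 := B.afterService_succ_le hmono x
    push_cast at e2
    linarith [hlow 0]

theorem exists_isValueFunction (lam : ℝ) : ∃ V : ℕ → ℝ, B.IsValueFunction lam V := by
  set α : ℕ → ℝ := fun k => 1 - 1 / ((k : ℝ) + 2) with hα
  have hα01 : ∀ k, 0 < α k ∧ α k < 1 := fun k => by
    have h2 : (0 : ℝ) < (k : ℝ) + 2 := by positivity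
    refine ⟨sub_pos.2 ((div_lt_one h2).2 ?_), sub_lt_self _ (by positivity)⟩
    linarith [Nat.cast_nonneg (α := ℝ) k]
  have hlim : Tendsto α atTop (𝓝 1) := by
    have h := (tendsto_one_div_add_atTop_nhds_zero_nat (𝕜 := ℝ)).comp (tendsto_add_atTop_nat 1)
    have h' := h.const_sub 1
    rw [sub_zero] at h'
    refine h'.congr fun k => ?_
    simp only [hα, Function.comp]
    push_cast
    ring
  set b : ℕ → ℝ := fun x =>
    ∑ i ∈ Finset.range x, (B.C * (i + 1) + 2 * |lam|) / (1 - B.serviceProb 0)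
  -- Tychonoff: pointwise bounds place all relative values in a compact product, in which a
  -- subsequence converges pointwise.
  have hK : IsCompact (Set.univ.pi fun x : ℕ => Set.Icc 0 (b x)) :=
    isCompact_univ_pi fun _ => isCompact_Icc
  obtain ⟨V, -, φ, hφ, hV⟩ := hK.tendsto_subseq
    (x := fun k x => B.discValue lam (α k) x - B.discValue lam (α k) 0) fun k x _ =>
      ⟨sub_nonneg.2 ((B.discValue_spec lam (hα01 k).1 (hα01 k).2).1 (Nat.zero_le x)),
        B.discValue_sub_le lam (hα01 k).1 (hα01 k).2 x⟩
  exact ⟨V, α ∘ φ, fun k => hα01 _, hlim.comp hφ.tendsto_atTop, tendsto_pi_nhds.1 hV⟩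

/-! ### Bounds on the average cost -/

theorem sum_discounted_le {c : ℕ → ℝ} {K : ℝ} (hc : ∀ N, ∑ n ∈ Finset.range N, c n ≤ K) {α : ℝ}
    (h0 : 0 ≤ α) (h1 : α ≤ 1) (N : ℕ) : ∑ n ∈ Finset.range N, α ^ n * c n ≤ K := by
  -- Summation by parts in inductive form: the slack `K - ∑ c n` is nonnegative and its weight `α ^
  -- N` decreases.
  have H : ∑ n ∈ Finset.range N, α ^ n * c n ≤
      K - α ^ N * (K - ∑ n ∈ Finset.range N, c n) := by
    induction N with
    | zero => simp
    | succ N ih =>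
      have h2 := mul_le_mul_of_nonneg_right (pow_le_pow_of_le_one h0 h1 (Nat.le_add_right N 1))
        (sub_nonneg.2 (hc (N + 1)))
      rw [Finset.sum_range_succ] at h2 ⊢
      rw [Finset.sum_range_succ c]
      linarith
  have := mul_nonneg (pow_nonneg h0 N) (sub_nonneg.2 (hc N))
  linarith

/-- If the normalized discounted cost of a policy is asymptotically at least `η` along a sequence
of discount factors with limit one, then so is its average cost. -/
theorem le_avgCost {lam η : ℝ} {α v : ℕ → ℝ} (hα : ∀ k, 0 < α k ∧ α k < 1)
    (hα1 : Tendsto α atTop (𝓝 1)) (π : Policy) (x : ℕ)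
    (hv : ∀ k, v k ≤ B.discCost lam (α k) π x)
    (hη : Tendsto (fun k => (1 - α k) * v k) atTop (𝓝 η)) :
    (η : EReal) ≤ B.avgCost lam π x := by
  by_contra hlt
  obtain ⟨L, hL1, hL2⟩ := EReal.lt_iff_exists_real_btwn.1 (not_le.1 hlt)
  have hev := eventually_lt_of_limsup_lt hL1
  rw [EReal.coe_lt_coe_iff] at hL2
  obtain ⟨N₀, hN₀⟩ := eventually_atTop.1 hev
  set c : ℕ → ℝ := fun n => B.stageCost lam π x n - L with hc
  have hsum : ∀ N, ∑ n ∈ Finset.range N, c n =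
      ∑ n ∈ Finset.range N, B.stageCost lam π x n - N * L := fun N => by
    simp [hc, Finset.sum_sub_distrib]
  -- Beyond `N₀` the partial sums of `c` are negative; `K` dominates the finitely many earlier ones.
  set K : ℝ := ∑ n ∈ Finset.range (N₀ + 1), |∑ i ∈ Finset.range n, c i| with hK
  have hK0 : 0 ≤ K := Finset.sum_nonneg fun _ _ => abs_nonneg _
  have hbdd : ∀ N, ∑ n ∈ Finset.range N, c n ≤ K := by
    intro N
    rcases le_or_gt N N₀ with h | h
    · exact (le_abs_self _).trans (Finset.single_le_sum
        (f := fun n => |∑ i ∈ Finset.range n, c i|) (fun _ _ => abs_nonneg _)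
        (Finset.mem_range.2 (by omega)))
    · have hN : (0 : ℝ) < N := by exact_mod_cast (Nat.zero_le N₀).trans_lt h
      have h2 := hN₀ N h.le
      rw [EReal.coe_lt_coe_iff, one_div, inv_mul_eq_div, div_lt_iff₀ hN] at h2
      rw [hsum]
      linarith
  have hdisc : ∀ k, (1 - α k) * v k ≤ (1 - α k) * K + L := by
    intro k
    obtain ⟨h0, h1⟩ := hα k
    have hpos : 0 < 1 - α k := sub_pos.2 h1
    have hs : Tendsto (fun N => ∑ n ∈ Finset.range N, α k ^ n * c n) atTop
        (𝓝 (B.discCost lam (α k) π x - (1 - α k)⁻¹ * L)) := by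
      have := (B.tendsto_sum_discounted_stageCost lam h0 h1 π x).sub
        (((hasSum_geometric_of_lt_one h0.le h1).tendsto_sum_nat).mul_const L)
      refine this.congr fun N => ?_
      rw [Finset.sum_mul, ← Finset.sum_sub_distrib]
      exact Finset.sum_congr rfl fun n _ => by simp only [hc]; ring
    have hle := le_of_tendsto' hs (sum_discounted_le hbdd h0.le h1.le)
    have h3 := mul_le_mul_of_nonneg_left ((hv k).trans (sub_le_iff_le_add.1 hle)) hpos.le
    rwa [mul_add, ← mul_assoc, mul_inv_cancel₀ hpos.ne', one_mul] at h3
  have hlim : Tendsto (fun k => (1 - α k) * K + L) atTop (𝓝 ((1 - 1) * K + L)) :=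
    ((hα1.const_sub 1).mul_const K).add_const L
  have := le_of_tendsto_of_tendsto' hη hlim hdisc
  linarith

/-- A stationary policy that attains the minimum in the average-cost dynamic programming equation
with a nonnegative solution has average cost at most the constant of the equation. -/
theorem avgCost_le {lam η : ℝ} {V : ℕ → ℝ} (hV : ∀ x, 0 ≤ V x) (f : ℕ → Bool)
    (hf : ∀ x, V x = B.C * x - η + B.actionValue lam V x (f x)) (x : ℕ) :
    B.avgCost lam (stationary fun y => PMF.pure (f y)) x ≤ (η : EReal) := by
  set π : Policy := stationary fun y => PMF.pure (f y) with hπ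
  have step : ∀ N : ℕ, ∑ n ∈ Finset.range N, B.stageCost lam π x n +
      (B.law π x N).expect (fun s => V s.2) = N * η + V x := by
    intro N
    induction N with
    | zero => simp [expect_law_zero]
    | succ N ih =>
      -- Adding `η` to the current value only, each slot contributes one `η` to the telescoping sum.
      have h := B.expect_law_eq_stageCost_add (V := fun y => V y + η) f
        (fun y => by rw [hf y]; ring) x N
      rw [PMF.expect_add _ (B.support_law_finite _ _ _),
        PMF.expect_const _ (B.support_law_finite _ _ _)] at h
      rw [Finset.sum_range_succ]
      push_cast
      linarith
  have hle : ∀ N : ℕ, ∑ n ∈ Finset.range N, B.stageCost lam π x n ≤ N * η + V x := by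
    intro N
    have hf := B.support_law_finite π x N
    have : 0 ≤ (B.law π x N).expect fun s => V s.2 := by
      rw [← PMF.expect_const _ hf 0]
      exact PMF.expect_mono _ hf fun s _ => hV s.2
    linarith [step N]
  have hlim : Tendsto (fun N : ℕ => ((η + V x / (N : ℝ) : ℝ) : EReal)) atTop (𝓝 (η : EReal)) := by
    refine (continuous_coe_real_ereal.tendsto _).comp ?_
    simpa using (tendsto_const_div_atTop_nhds_zero_nat (V x)).const_add η
  refine (limsup_le_limsup ?_).trans hlim.limsup_eq.le
  filter_upwards [eventually_gt_atTop 0] with N hN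
  have hN' : (0 : ℝ) < N := by exact_mod_cast hN
  rw [EReal.coe_le_coe_iff, one_div, inv_mul_eq_div, div_le_iff₀ hN', add_mul,
    div_mul_cancel₀ _ hN'.ne']
  linarith [hle N]

/-! ### Finiteness of the threshold and passage to the limit -/

/-- Accepting is strictly worse than rejecting in some state. -/
theorem exists_rejectTerm_lt_acceptTerm {lam η : ℝ} {V : ℕ → ℝ} (hm : Monotone V)
    (hc : SeqConvex V) (hV : B.SolvesDPE lam V η) :
    ∃ x, 0 < B.acceptTerm V x - B.rejectTerm lam V x := by
  by_contra! hneg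
  have hslope : ∀ y, V (y + 1) - V y ≤ lam / B.p := by
    intro y
    -- Starting at `y + M`, at least `y` users remain after service, so the expected increment there
    -- dominates the increment at `y`.
    have h1 := hneg (y + B.M)
    rw [acceptTerm_sub_rejectTerm] at h1
    have h2 : V (y + 1) - V y ≤ B.afterService (fun y => V (y + 1) - V y) (y + B.M) := by
      rw [← B.afterService_const (V (y + 1) - V y) (y + B.M)]
      refine Finset.sum_le_sum fun d hd => ?_
      rw [Finset.mem_range] at hd
      exact mul_le_mul_of_nonneg_left (hc.monotone_diff (show y ≤ y + B.M - d by omega))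
        (B.serviceProb_nonneg d)
    rw [le_div_iff₀ B.p_pos]
    have := mul_le_mul_of_nonneg_right h2 B.p_pos.le
    linarith
  have hgrowth : ∀ y n : ℕ, V (y + n) ≤ V y + n * (lam / B.p) := by
    intro y n
    induction n with
    | zero => simp
    | succ n ih =>
      have := hslope (y + n)
      rw [← add_assoc]
      push_cast
      linarith
  have hlower : ∀ y : ℕ, B.C * y - η + V y ≤ V (y + B.M) := by
    intro y
    have h1 : V y ≤ B.acceptTerm V (y + B.M) := by
      rw [acceptTerm_eq, ← B.afterService_const (V y) (y + B.M)]
      refine Finset.sum_le_sum fun d hd => mul_le_mul_of_nonneg_left ?_ (B.serviceProb_nonneg d)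
      rw [Finset.mem_range] at hd
      have h2 := mul_le_mul_of_nonneg_left
        (hm (show y ≤ y + B.M - d + 1 by omega)) B.p_pos.le
      have h3 := mul_le_mul_of_nonneg_left
        (hm (show y ≤ y + B.M - d by omega)) (sub_nonneg.2 B.p_le_one)
      linarith
    have h4 := hV (y + B.M)
    rw [min_eq_left (sub_nonpos.1 (hneg _))] at h4
    have h5 := mul_nonneg B.C_pos.le (Nat.cast_nonneg (α := ℝ) B.M)
    push_cast at h4
    linarith
  -- `hlower` makes the increase of `V` over `M` states grow linearly in `y`, while `hgrowth` caps
  -- it at `M * (lam / p)`.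
  obtain ⟨y, hy⟩ := exists_nat_gt ((η + B.M * (lam / B.p)) / B.C)
  rw [div_lt_iff₀ B.C_pos] at hy
  linarith [hlower y, hgrowth y B.M]

/-- No further subsequence is needed for `η`: at state `0` the relative equation expresses `(1 - α)
* V^α 0` through quantities that already converge. -/
theorem IsValueFunction.spec {lam : ℝ} {V : ℕ → ℝ} (h : B.IsValueFunction lam V) :
    Monotone V ∧ SeqConvex V ∧ (∀ x, 0 ≤ V x) ∧ ∃ η : ℝ, B.SolvesDPE lam V η ∧
      ∀ π x, (η : EReal) ≤ B.avgCost lam π x := by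
  obtain ⟨α, hα, hα1, hV⟩ := h
  have hspec := fun k => B.discValue_spec lam (hα k).1 (hα k).2
  have hm : Monotone V := monotone_of_tendsto
    (fun k _ _ hxy => sub_le_sub_right ((hspec k).1 hxy) (B.discValue lam (α k) 0)) hV
  have hc : SeqConvex V := seqConvex_of_tendsto (fun k x => by
    linarith [(hspec k).2.1 x]) hV
  have hV0 : V 0 = 0 := tendsto_nhds_unique (hV 0) (by simp)
  have hαV := fun y => hα1.mul (hV y)
  simp only [one_mul] at hαV
  have hT := B.tendsto_bellman lam hαV
  have heq := fun k => B.discValue_sub_eq lam (hα k).1 (hα k).2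
  have hη : Tendsto (fun k => (1 - α k) * B.discValue lam (α k) 0) atTop
      (𝓝 (B.bellman lam V 0)) := by
    refine (hT 0).congr fun k => ?_
    have := heq k 0
    rw [sub_self] at this
    linarith
  refine ⟨hm, hc, fun x => hV0 ▸ hm (Nat.zero_le x), B.bellman lam V 0, fun x => ?_, fun π x => ?_⟩
  · have h2 := tendsto_nhds_unique (hV x) (((hT x).sub hη).congr fun k => (heq k x).symm)
    rw [h2, bellman]
    ring
  · refine B.le_avgCost hα hα1 π x (fun k => (hspec k).2.2.2.2 π x) ?_
    have h3 := ((hα1.const_sub 1).mul (hV x)).add hη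
    rw [sub_self, zero_mul, zero_add] at h3
    exact h3.congr fun k => by ring

end BaseStation

/-- For every tax `lam`: a value function exists, and for every value function `V`, with `η` the
optimal average cost, the states in which accepting attains the minimum in the dynamic programming
equation are exactly those `≤ t`, those in which rejecting attains it are exactly those `> s`
(so both are optimal exactly in the states in `(s, t]`), and every threshold policy with threshold
in `[s, t]` is average-cost optimal, among all non-anticipating policies, from every initial
state. -/
theorem lemma4 (B : BaseStation) (lam : ℝ) :
    (∃ V : ℕ → ℝ, B.IsValueFunction lam V) ∧
    ∀ V : ℕ → ℝ, B.IsValueFunction lam V →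
      ∃ (η : ℝ) (s t : ℤ), -1 ≤ s ∧ s ≤ t ∧
        B.SolvesDPE lam V η ∧
        (∀ x : ℕ, B.acceptTerm V x ≤ B.rejectTerm lam V x ↔ (x : ℤ) ≤ t) ∧
        (∀ x : ℕ, B.rejectTerm lam V x ≤ B.acceptTerm V x ↔ s < (x : ℤ)) ∧
        ∀ k : ℤ, s ≤ k → k ≤ t → ∀ x : ℕ,
          B.avgCost lam (BaseStation.thresholdPolicy k) x = (η : EReal) ∧
          ∀ π : BaseStation.Policy, (η : EReal) ≤ B.avgCost lam π x := by
  classical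
  refine ⟨B.exists_isValueFunction lam, fun V hV => ?_⟩
  obtain ⟨hm, hc, hnonneg, η, hdpe, hopt⟩ := hV.spec
  have hd := B.monotone_acceptTerm_sub_rejectTerm lam hc
  have hex := B.exists_rejectTerm_lt_acceptTerm hm hc hdpe
  have hex' : ∃ x, 0 ≤ B.acceptTerm V x - B.rejectTerm lam V x := hex.imp fun _ h => h.le
  -- `t + 1` is the first state where accept minus reject is positive, `s + 1` the first where it is
  -- nonnegative; the value `-1` occurs when that state is `0`.
  have ht : ∀ x : ℕ, B.acceptTerm V x ≤ B.rejectTerm lam V x ↔ (x : ℤ) ≤ (Nat.find hex : ℤ) - 1 := by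
    intro x
    rw [← sub_nonpos, ← not_lt, Int.le_sub_one_iff, Nat.cast_lt, ← not_le (a := Nat.find hex)]
    exact not_congr ⟨fun h => Nat.find_min' hex h, fun h => (Nat.find_spec hex).trans_le (hd h)⟩
  have hs : ∀ x : ℕ, B.rejectTerm lam V x ≤ B.acceptTerm V x ↔
      (Nat.find hex' : ℤ) - 1 < (x : ℤ) := by
    intro x
    rw [← sub_nonneg, Int.sub_one_lt_iff, Nat.cast_le]
    exact ⟨fun h => Nat.find_min' hex' h, fun h => (Nat.find_spec hex').trans (hd h)⟩
  have hst : Nat.find hex' ≤ Nat.find hex := Nat.find_min' hex' (Nat.find_spec hex).le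
  refine ⟨η, Nat.find hex' - 1, Nat.find hex - 1, by omega, by omega, hdpe, ht, hs,
    fun k hsk hkt x => ⟨le_antisymm (B.avgCost_le hnonneg (fun y => decide ((y : ℤ) ≤ k))
      (fun y => ?_) x) (hopt _ x), fun π => hopt π x⟩⟩
  rw [hdpe y]
  by_cases hy : (y : ℤ) ≤ k
  · simp [BaseStation.actionValue, hy, (ht y).2 (hy.trans hkt)]
  · simp [BaseStation.actionValue, hy, (hs y).2 (hsk.trans_lt (not_le.1 hy))]
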